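/- Let $d\ge 1$ and let $X_d=(\mathbb{Z}/2\mathbb{Z})^{\mathbb{Z}^d}$, a compact abelian group under coordinatewise addition and the topology of pointwise convergence, with the shift action $S(\mathbf{j})(x)(\mathbf{i})=x(\mathbf{i}+\mathbf{j})$ of $\mathbb{Z}^d$ and the coordinatewise product $(x\star y)(\mathbf{i})=x(\mathbf{i})\,y(\mathbf{i})$. A Markov subgroup of $X_d$ is a closed shift-invariant subgroup. For a compact abelian group $X$, $\lambda_X$ denotes its normalized Haar measure. An action $\alpha$ of $\mathbb{Z}^d$ on $X$ by continuous automorphisms is mixing if $\lambda_X(A\cap\alpha(\mathbf{n})^{-1}B)\to\lambda_X(A)\lambda_X(B)$ as $\mathbf{n}\to\infty$ for all Borel sets $A,B\subset X$. A map $f:X\to X$ is affine if there are $c\in X$ and a continuous surjective homomorphism $\theta:X\to X$ with $f(x)=c+\theta(x)$ for $\lambda_X$-almost every $x$. **Proposition.** Let $H,K\subset X_d$ be proper Markov subgroups with $H\neq\{0\}$, such that the shift actions $(H,S)$ and $(K,S)$ are mixing and $x\star y\in K$ for all $x,y\in H$. Put $$(X,\alpha)=(H,S)\times(H,S)\times(K,S),\qquad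 f:X\to X,\quad f(x,y,z)=(x,\,y,\,x\star y+z).$$ Then $(X,\alpha)$ is a mixing action of $\mathbb{Z}^d$ of zero entropy (both the measure-theoretic entropy with respect to $\lambda_X$ and the topological entropy of $\alpha$ are $0$), and $f$ is a non-affine homeomorphism which preserves $\lambda_X$ and commutes with $\alpha$. -/

import Mathlib

open MeasureTheory Filter Topology
open scoped ENNReal

/-- An algebraic `ℤ^d`-action: an action of `ℤ^d` on a topological abelian group `X` by
continuous automorphisms (homeomorphic group automorphisms). -/
structure AlgebraicAction (d : ℕ) (X : Type*) [AddCommGroup X] [TopologicalSpace X] where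
  act : (Fin d → ℤ) → (X ≃ₜ+ X)
  act_zero : ∀ x, act 0 x = x
  act_add : ∀ m n x, act (m + n) x = act m (act n x)

/-- The product of two algebraic actions, `(m, (x, y)) ↦ (α m x, β m y)`. -/
def AlgebraicAction.prod {d : ℕ} {X Y : Type*} [AddCommGroup X] [TopologicalSpace X]
    [AddCommGroup Y] [TopologicalSpace Y] (α : AlgebraicAction d X) (β : AlgebraicAction d Y) :
    AlgebraicAction d (X × Y) where
  act n :=
    { toFun := fun p => (α.act n p.1, β.act n p.2)
      invFun := fun p => ((α.act n).symm p.1, (β.act n).symm p.2)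
      left_inv := fun p => by simp
      right_inv := fun p => by simp
      map_add' := fun p q => by simp
      continuous_toFun :=
        ((α.act n).continuous_toFun.comp continuous_fst).prodMk
          ((β.act n).continuous_toFun.comp continuous_snd)
      continuous_invFun :=
        ((α.act n).continuous_invFun.comp continuous_fst).prodMk
          ((β.act n).continuous_invFun.comp continuous_snd) }
  act_zero p := Prod.ext (α.act_zero p.1) (β.act_zero p.2)
  act_add m n p := Prod.ext (α.act_add m n p.1) (β.act_add m n p.2)

/-- The normalized Haar measure `λ_X` of a compact abelian group `X`. -/
noncomputable def haarProb (X : Type*) [AddCommGroup X] [TopologicalSpace X]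
    [IsTopologicalAddGroup X] [CompactSpace X] [MeasurableSpace X] [BorelSpace X] : Measure X :=
  Measure.addHaarMeasure (⊤ : TopologicalSpace.PositiveCompacts X)

/-- The cube `{0, …, n - 1}^d ⊂ ℤ^d`. -/
noncomputable def cube (d n : ℕ) : Finset (Fin d → ℤ) :=
  Fintype.piFinset fun _ => Finset.Ico (0 : ℤ) n

section Dynamics

variable {d : ℕ} {X : Type*} [AddCommGroup X] [TopologicalSpace X]

/-- Mixing with respect to Haar measure: `λ(A ∩ α(n)⁻¹ B) → λ(A) λ(B)` as `n → ∞` in `ℤ^d`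
(that is, along the complements of finite sets) for all Borel sets `A`, `B`. -/
def AlgebraicAction.IsMixing [IsTopologicalAddGroup X] [CompactSpace X] [MeasurableSpace X]
    [BorelSpace X] (α : AlgebraicAction d X) : Prop :=
  ∀ A B : Set X, MeasurableSet A → MeasurableSet B →
    Tendsto (fun n : Fin d → ℤ => haarProb X (A ∩ α.act n ⁻¹' B)) cofinite
      (𝓝 (haarProb X A * haarProb X B))

/-- Shannon entropy `-∑ μ(P_i) log μ(P_i)` of the finite partition of `X` into the fibres
`P_i = φ⁻¹{i}` of a map `φ` into a finite set. -/
noncomputable def partitionEntropy [MeasurableSpace X] {ι : Type*} [Fintype ι]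
    (μ : Measure X) (φ : X → ι) : ℝ :=
  ∑ i : ι, Real.negMulLog (μ.real (φ ⁻¹' {i}))

/-- The Kolmogorov–Sinai entropy `h_λ(α)` of `α` with respect to Haar measure: the supremum,
over all finite measurable partitions `P` of `X` (given by measurable labellings `φ`), of the limit
of `n^{-d} H(⋁_{i ∈ {0,…,n-1}^d} α(i)⁻¹ P)`. -/
noncomputable def AlgebraicAction.metricEntropy [IsTopologicalAddGroup X] [CompactSpace X]
    [MeasurableSpace X] [BorelSpace X] (α : AlgebraicAction d X) : ℝ≥0∞ :=
  ⨆ (k : ℕ) (φ : X → Fin k) (_ : Measurable φ),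
    limsup (fun n : ℕ => ENNReal.ofReal
      (partitionEntropy (haarProb X) (fun x (i : cube d n) => φ (α.act i x)) / (n : ℝ) ^ d)) atTop

/-- The minimal number of members of the cover `U` that are needed to cover `X`. -/
noncomputable def coverNumber {X ι : Type*} (U : ι → Set X) : ℕ :=
  sInf {m : ℕ | ∃ T : Finset ι, T.card = m ∧ ⋃ i ∈ T, U i = Set.univ}

/-- The topological entropy of `α`: the supremum, over all finite open covers `U` of `X`, of the
limit of `n^{-d} log N(⋁_{i ∈ {0,…,n-1}^d} α(i)⁻¹ U)`. -/
noncomputable def AlgebraicAction.topEntropy (α : AlgebraicAction d X) : ℝ≥0∞ :=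
  ⨆ (k : ℕ) (U : Fin k → Set X) (_ : ∀ j, IsOpen (U j)) (_ : ⋃ j, U j = Set.univ),
    limsup (fun n : ℕ => ENNReal.ofReal
      (Real.log (coverNumber fun w : cube d n → Fin k => ⋂ i : cube d n, α.act i ⁻¹' U (w i)) /
        (n : ℝ) ^ d)) atTop

/-- A map `f : X → Y` between compact abelian groups is affine if it agrees almost everywhere
with `x ↦ c + θ x` for a constant `c` and a continuous surjective homomorphism `θ`. -/
def IsAffineMap {X Y : Type*} [AddCommGroup X] [TopologicalSpace X] [IsTopologicalAddGroup X]
    [CompactSpace X] [MeasurableSpace X] [BorelSpace X] [AddCommGroup Y] [TopologicalSpace Y]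
    (f : X → Y) : Prop :=
  ∃ (c : Y) (θ : X →ₜ+ Y), Function.Surjective θ ∧ ∀ᵐ x ∂(haarProb X), f x = c + θ x

end Dynamics

/-- The compact ring `X_d = (ℤ/2)^{ℤ^d}` with the topology of pointwise convergence and
pointwise operations; its multiplication is the coordinatewise product `⋆`. -/
abbrev ConfigSpace (d : ℕ) : Type := (Fin d → ℤ) → ZMod 2

/-- The shift `S(j)(x)(i) = x(i + j)`. -/
def configShift {d : ℕ} (j : Fin d → ℤ) (x : ConfigSpace d) : ConfigSpace d :=
  fun i => x (i + j)

theorem continuous_configShift {d : ℕ} (j : Fin d → ℤ) :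
    Continuous (configShift j : ConfigSpace d → ConfigSpace d) :=
  continuous_pi fun i => continuous_apply (i + j)

/-- A Markov subgroup of `X_d`: a closed shift-invariant subgroup. -/
structure MarkovSubgroup (d : ℕ) extends AddSubgroup (ConfigSpace d) where
  isClosed' : IsClosed carrier
  shift_mem' : ∀ (j : Fin d → ℤ) (x : ConfigSpace d), x ∈ carrier → configShift j x ∈ carrier

/-- The compact abelian group underlying a Markov subgroup. -/
abbrev MarkovSubgroup.Carrier {d : ℕ} (H : MarkovSubgroup d) : Type := H.toAddSubgroup

instance {d : ℕ} (H : MarkovSubgroup d) : CompactSpace H.Carrier :=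
  isCompact_iff_compactSpace.mp H.isClosed'.isCompact

instance {d : ℕ} (H : MarkovSubgroup d) : SecondCountableTopology H.Carrier :=
  TopologicalSpace.Subtype.secondCountableTopology (H.toAddSubgroup : Set (ConfigSpace d))

/-- The shift action `(H, S)` on a Markov subgroup `H`. -/
def MarkovSubgroup.shiftAction {d : ℕ} (H : MarkovSubgroup d) : AlgebraicAction d H.Carrier where
  act j :=
    { toFun := fun x => ⟨configShift j x.1, H.shift_mem' j x.1 x.2⟩
      invFun := fun x => ⟨configShift (-j) x.1, H.shift_mem' (-j) x.1 x.2⟩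
      left_inv := fun x => Subtype.ext (funext fun i => by simp [configShift])
      right_inv := fun x => Subtype.ext (funext fun i => by simp [configShift])
      map_add' := fun _ _ => rfl
      continuous_toFun := ((continuous_configShift j).comp continuous_subtype_val).subtype_mk _
      continuous_invFun := ((continuous_configShift (-j)).comp continuous_subtype_val).subtype_mk _ }
  act_zero x := Subtype.ext (funext fun i => by simp [configShift])
  act_add m n x := Subtype.ext (funext fun i => by
    change x.1 (i + (m + n)) = x.1 (i + m + n)
    rw [add_assoc])

/-- The action `(X, α) = (H, S) × (H, S) × (K, S)`. -/
def tripleAction {d : ℕ} (H K : MarkovSubgroup d) :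
    AlgebraicAction d (H.Carrier × H.Carrier × K.Carrier) :=
  H.shiftAction.prod (H.shiftAction.prod K.shiftAction)

/-- The map `f(x, y, z) = (x, y, x ⋆ y + z)` on `H × H × K`, where `x ⋆ y ∈ K` for
all `x, y ∈ H`. -/
def tripleMap {d : ℕ} (H K : MarkovSubgroup d)
    (hHK : ∀ x ∈ H.toAddSubgroup, ∀ y ∈ H.toAddSubgroup, x * y ∈ K.toAddSubgroup) :
    H.Carrier × H.Carrier × K.Carrier → H.Carrier × H.Carrier × K.Carrier :=
  fun p => (p.1, p.2.1, ⟨p.1.1 * p.2.1.1, hHK _ p.1.2 _ p.2.1.2⟩ + p.2.2)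

/-! Both entropies vanish because of one finite linear relation. Since a proper Markov subgroup is
closed, it misses some pattern on a finite window; linear algebra over `ZMod 2` and shift-invariance
then give a nonempty finite `S` such that every translate of `S` has coordinate sum zero
(`MarkovSubgroup.exists_relation`). Solving for the lexicographically largest site of `S` propagates
agreement of two configurations from a boundary layer of fixed width to the whole cube
(`eqOn_of_relation`), so only `2 ^ o(n ^ d)` patterns occur on a cube of side `n`
(`MarkovSubgroup.hasSubexpNames_symbol`).

The symbol at the origin separates orbits, and both this property and the subexponential count pass
to products. By compactness, open covers are refined by functions of a finite window; by regularity,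
measurable partitions are approximated by such functions. Hence both entropies are zero
(`IsGenerator.topEntropy_eq_zero`, `IsGenerator.metricEntropy_eq_zero`).

Mixing of the product need only be tested on measurable rectangles, where it factors. The map `f` is
a shear over `H × H`, a translation of `K` on each fibre, so Fubini gives invariance of Haar
measure, and characteristic 2 makes `f` an involution. Its biadditive term is what prevents
affinity: on `(x, 0, 0) + (0, x, 0)` additivity would force `x ⋆ x = 0`, so `x = 0`. -/

/-! ### Shannon entropy of finite partitions -/

section Shannon

/-- Gibbs' inequality term by term, from `log t ≤ t - 1` at `t = q / p`. The error `q - p` cancels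
when summed over two probability vectors. -/
theorem Real.negMulLog_le_of_imp {p q : ℝ} (hp : 0 ≤ p) (hq : 0 ≤ q) (h : q = 0 → p = 0) :
    Real.negMulLog p ≤ -p * Real.log q + (q - p) := by
  rcases hp.eq_or_lt with rfl | hp
  · simpa using hq
  have hq' : 0 < q := lt_of_le_of_ne hq fun h0 => hp.ne' (h h0.symm)
  have h1 := Real.log_le_sub_one_of_pos (div_pos hq' hp)
  rw [Real.log_div hq'.ne' hp.ne'] at h1
  have h2 := mul_le_mul_of_nonneg_left h1 hp.le
  have h3 : p * (q / p - 1) = q - p := by field_simp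
  rw [h3] at h2
  simp only [Real.negMulLog]
  linarith

theorem sum_measureReal_inter_fibre {X : Type*} [MeasurableSpace X] {κ : Type*} [Fintype κ]
    [MeasurableSpace κ] [MeasurableSingletonClass κ] (μ : Measure X) [IsProbabilityMeasure μ] {ψ : X → κ} (hψ : Measurable ψ) (A : Set X) :
    ∑ j, μ.real (A ∩ ψ ⁻¹' {j}) = μ.real A := by
  classical
  have h := measureReal_biUnion_finset (μ := μ.restrict A) (s := Finset.univ)
    (f := fun j => ψ ⁻¹' {j}) (fun i _ j _ hij => by
      refine Set.disjoint_left.2 fun x hx hx' => hij ?_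
      exact hx.symm.trans hx') (fun j _ => hψ (measurableSet_singleton j))
  have hU : (⋃ j ∈ (Finset.univ : Finset κ), ψ ⁻¹' {j}) = Set.univ := by
    ext x; simp
  rw [hU] at h
  simp only [measureReal_restrict_apply (hψ (measurableSet_singleton _)),
    measureReal_restrict_apply MeasurableSet.univ, Set.univ_inter] at h
  rw [h]
  exact Finset.sum_congr rfl fun j _ => by rw [Set.inter_comm]

theorem sum_measureReal_fibre {X : Type*} [MeasurableSpace X] {κ : Type*} [Fintype κ]
    [MeasurableSpace κ] [MeasurableSingletonClass κ] (μ : Measure X) [IsProbabilityMeasure μ] {ψ : X → κ} (hψ : Measurable ψ) :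
    ∑ j, μ.real (ψ ⁻¹' {j}) = 1 := by
  simpa using sum_measureReal_inter_fibre μ hψ Set.univ

/-- Each fibre of `φ` is a union of fibres of `ψ`, and `-log` is decreasing, so replacing the mass
of the union by that of each piece only increases the sum. -/
theorem partitionEntropy_comp_le {X : Type*} [MeasurableSpace X] {ι κ : Type*} [Fintype ι]
    [Fintype κ] [MeasurableSpace κ] [MeasurableSingletonClass κ] (μ : Measure X)
    [IsProbabilityMeasure μ] {ψ : X → κ} (hψ : Measurable ψ) {φ : X → ι}
    (f : κ → ι) (h : ∀ x, φ x = f (ψ x)) :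
    partitionEntropy μ φ ≤ partitionEntropy μ ψ := by
  classical
  unfold partitionEntropy
  have key : ∀ i, Real.negMulLog (μ.real (φ ⁻¹' {i})) ≤
      ∑ j, if f j = i then Real.negMulLog (μ.real (ψ ⁻¹' {j})) else 0 := by
    intro i
    have h1 : μ.real (φ ⁻¹' {i}) = ∑ j, if f j = i then μ.real (ψ ⁻¹' {j}) else 0 := by
      rw [← sum_measureReal_inter_fibre μ hψ]
      refine Finset.sum_congr rfl fun j _ => ?_
      split_ifs with hj
      · congr 1
        ext x
        simp only [Set.mem_inter_iff, Set.mem_preimage, Set.mem_singleton_iff, h]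
        exact ⟨fun h => h.2, fun h => ⟨by rw [h, hj], h⟩⟩
      · rw [← measureReal_empty (μ := μ)]
        congr 1
        ext x
        simp only [Set.mem_inter_iff, Set.mem_preimage, Set.mem_singleton_iff, h,
          Set.mem_empty_iff_false, iff_false]
        rintro ⟨h1, rfl⟩
        exact hj h1
    have h2 : Real.negMulLog (μ.real (φ ⁻¹' {i})) =
        ∑ j, (if f j = i then μ.real (ψ ⁻¹' {j}) else 0) * -Real.log (μ.real (φ ⁻¹' {i})) := by
      rw [← Finset.sum_mul, ← h1, Real.negMulLog]
      ring
    rw [h2]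
    refine Finset.sum_le_sum fun j _ => ?_
    split_ifs with hj
    · have hle : μ.real (ψ ⁻¹' {j}) ≤ μ.real (φ ⁻¹' {i}) := by
        refine measureReal_mono fun x hx => ?_
        simp only [Set.mem_preimage, Set.mem_singleton_iff] at hx ⊢
        rw [h, hx, hj]
      rcases (measureReal_nonneg (μ := μ) (s := ψ ⁻¹' {j})).eq_or_lt with h0 | h0
      · simp [← h0]
      · have := mul_le_mul_of_nonneg_left (Real.log_le_log h0 hle) h0.le
        rw [Real.negMulLog]
        linarith
    · simp
  refine (Finset.sum_le_sum fun i _ => key i).trans ?_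
  rw [Finset.sum_comm]
  simp

/-- `negMulLog` is continuous and vanishes at 0 and 1. The bound `ε` depends only on `ι`, `a`, `μ`
and `δ`, so it can be fixed before the approximating labelling is chosen. -/
theorem exists_partitionEntropy_le_of_concentrated {X : Type*} [MeasurableSpace X]
    {ι : Type*} [Fintype ι] (μ : Measure X) [IsProbabilityMeasure μ] (a : ι) {δ : ℝ} (hδ : 0 < δ) :
    ∃ ε > 0, ∀ e : X → ι, MeasurableSet (e ⁻¹' {a}) → μ.real {x | e x ≠ a} ≤ ε →
      partitionEntropy μ e ≤ δ := by
  have hN : (0 : ℝ) < Fintype.card ι := by exact_mod_cast Fintype.card_pos_iff.2 ⟨a⟩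
  have hδ' : 0 < δ / Fintype.card ι := div_pos hδ hN
  obtain ⟨r, hr, h0⟩ := Metric.continuousAt_iff.1
    (Real.continuous_negMulLog.continuousAt (x := 0)) (δ / Fintype.card ι) hδ'
  obtain ⟨r', hr', h1⟩ := Metric.continuousAt_iff.1
    (Real.continuous_negMulLog.continuousAt (x := 1)) (δ / Fintype.card ι) hδ'
  refine ⟨min r r' / 2, by positivity, fun e he hμ => ?_⟩
  have hm : min r r' / 2 < min r r' := half_lt_self (by positivity)
  have key : ∀ i, Real.negMulLog (μ.real (e ⁻¹' {i})) ≤ δ / Fintype.card ι := by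
    intro i
    by_cases hi : i = a
    · subst hi
      have hc : μ.real {x | e x ≠ i} = 1 - μ.real (e ⁻¹' {i}) := by
        rw [← probReal_compl_eq_one_sub he]
        rfl
      have := @h1 (μ.real (e ⁻¹' {i})) (by
        rw [Real.dist_eq, abs_sub_comm, ← hc, abs_of_nonneg measureReal_nonneg]
        exact (hμ.trans_lt hm).trans_le (min_le_right _ _))
      rw [Real.dist_eq, Real.negMulLog_one, sub_zero] at this
      exact (le_abs_self _).trans this.le
    · have hle : μ.real (e ⁻¹' {i}) ≤ μ.real {x | e x ≠ a} := by
        refine measureReal_mono fun x hx => ?_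
        simp only [Set.mem_preimage, Set.mem_singleton_iff] at hx
        simpa [hx] using hi
      have := @h0 (μ.real (e ⁻¹' {i})) (by
        rw [Real.dist_eq, sub_zero, abs_of_nonneg measureReal_nonneg]
        exact ((hle.trans hμ).trans_lt hm).trans_le (min_le_left _ _))
      rw [Real.dist_eq, Real.negMulLog_zero, sub_zero] at this
      exact (le_abs_self _).trans this.le
  unfold partitionEntropy
  refine (Finset.sum_le_sum fun i _ => key i).trans ?_
  rw [Finset.sum_const, Finset.card_univ, nsmul_eq_mul]
  field_simp
  exact le_rfl

theorem partitionEntropy_comp_of_measurePreserving {X Y ι : Type*} [MeasurableSpace X]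
    [MeasurableSpace Y] [Fintype ι] [MeasurableSpace ι] [MeasurableSingletonClass ι]
    {μ : Measure X} {ν : Measure Y}
    {T : Y → X} (hT : MeasurePreserving T ν μ) {φ : X → ι} (hφ : Measurable φ) :
    partitionEntropy ν (fun y => φ (T y)) = partitionEntropy μ φ := by
  unfold partitionEntropy
  refine Finset.sum_congr rfl fun i _ => ?_
  have := hT.measureReal_preimage (hφ (measurableSet_singleton i)).nullMeasurableSet
  rw [← this]
  rfl

variable {X : Type*} [MeasurableSpace X] {ι κ : Type*} [Fintype ι] [Fintype κ]
  [MeasurableSpace ι] [MeasurableSpace κ] [MeasurableSingletonClass ι]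
  [MeasurableSingletonClass κ] (μ : Measure X) [IsProbabilityMeasure μ]

/-- Gibbs' inequality for the joint distribution against the product of its marginals. -/
theorem partitionEntropy_prodMk_le {φ : X → ι} {ψ : X → κ} (hφ : Measurable φ)
    (hψ : Measurable ψ) :
    partitionEntropy μ (fun x => (φ x, ψ x)) ≤ partitionEntropy μ φ + partitionEntropy μ ψ := by
  unfold partitionEntropy
  rw [Fintype.sum_prod_type]
  set p : ι → κ → ℝ := fun i j => μ.real (φ ⁻¹' {i} ∩ ψ ⁻¹' {j}) with hp
  have hpre : ∀ i j, μ.real ((fun x => (φ x, ψ x)) ⁻¹' {(i, j)}) = p i j := by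
    intro i j
    rw [hp]
    congr 1
    ext x
    simp
  have hr : ∀ i, ∑ j, p i j = μ.real (φ ⁻¹' {i}) := fun i =>
    sum_measureReal_inter_fibre μ hψ _
  have hc : ∀ j, ∑ i, p i j = μ.real (ψ ⁻¹' {j}) := fun j => by
    rw [← sum_measureReal_inter_fibre μ hφ]
    exact Finset.sum_congr rfl fun i _ => by rw [hp]; simp only [Set.inter_comm]
  have hle : ∀ i j, Real.negMulLog (p i j) ≤ -(p i j * Real.log (μ.real (φ ⁻¹' {i}))) +
      -(p i j * Real.log (μ.real (ψ ⁻¹' {j}))) +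
      (μ.real (φ ⁻¹' {i}) * μ.real (ψ ⁻¹' {j}) - p i j) := by
    intro i j
    have h1 : p i j ≤ μ.real (φ ⁻¹' {i}) := measureReal_mono Set.inter_subset_left
    have h2 : p i j ≤ μ.real (ψ ⁻¹' {j}) := measureReal_mono Set.inter_subset_right
    have h0 : 0 ≤ p i j := measureReal_nonneg
    rcases h0.eq_or_lt with h0 | h0
    · rw [← h0]
      simp only [Real.negMulLog_zero, zero_mul, neg_zero, zero_add, sub_zero]
      positivity
    have ha := h0.trans_le h1
    have hb := h0.trans_le h2
    have := Real.negMulLog_le_of_imp h0.le (mul_pos ha hb).le fun h => absurd h (mul_pos ha hb).ne'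
    rw [Real.log_mul ha.ne' hb.ne'] at this
    linarith
  simp only [hpre]
  refine (Finset.sum_le_sum fun i _ => Finset.sum_le_sum fun j _ => hle i j).trans ?_
  simp only [Finset.sum_add_distrib, Finset.sum_sub_distrib, hr, ← Finset.mul_sum,
    Finset.sum_neg_distrib, ← Finset.sum_mul, sum_measureReal_fibre μ hφ,
    sum_measureReal_fibre μ hψ]
  rw [Finset.sum_comm (f := fun i j => p i j * Real.log (μ.real (ψ ⁻¹' {j})))]
  simp only [← Finset.sum_mul, hc, Real.negMulLog, neg_mul, Finset.sum_neg_distrib]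
  simp

/-- Gibbs' inequality against the uniform distribution on the labels that occur. -/
theorem partitionEntropy_le_log_ncard_range {φ : X → ι} (hφ : Measurable φ) :
    partitionEntropy μ φ ≤ Real.log (Set.range φ).ncard := by
  classical
  unfold partitionEntropy
  set T : Finset ι := (Set.range φ).toFinset with hT
  have hcard : (Set.range φ).ncard = T.card := Set.ncard_eq_toFinset_card' _
  have hout : ∀ i ∉ T, μ.real (φ ⁻¹' {i}) = 0 := by
    intro i hi
    rw [← measureReal_empty (μ := μ)]
    congr 1
    ext x
    simp only [Set.mem_preimage, Set.mem_singleton_iff, Set.mem_empty_iff_false, iff_false]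
    rintro rfl
    exact hi (by simp [hT])
  have hsum : ∑ i ∈ T, μ.real (φ ⁻¹' {i}) = 1 := by
    rw [← sum_measureReal_fibre μ hφ]
    exact Finset.sum_subset (Finset.subset_univ _) fun i _ hi => hout i hi
  have hTpos : (0 : ℝ) < T.card := by
    rw [Nat.cast_pos, Finset.card_pos]
    by_contra h
    rw [Finset.not_nonempty_iff_eq_empty] at h
    simp [h] at hsum
  rw [hcard, ← Finset.sum_subset (Finset.subset_univ T) fun i _ hi => by simp [hout i hi]]
  have hle : ∀ i ∈ T, Real.negMulLog (μ.real (φ ⁻¹' {i})) ≤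
      μ.real (φ ⁻¹' {i}) * Real.log T.card + ((T.card : ℝ)⁻¹ - μ.real (φ ⁻¹' {i})) := by
    intro i _
    have := Real.negMulLog_le_of_imp (measureReal_nonneg (μ := μ) (s := φ ⁻¹' {i}))
      (inv_pos.2 hTpos).le fun h => absurd h (inv_pos.2 hTpos).ne'
    rw [Real.log_inv] at this
    linarith
  refine (Finset.sum_le_sum hle).trans ?_
  rw [Finset.sum_add_distrib, Finset.sum_sub_distrib, ← Finset.sum_mul, hsum]
  simp [hTpos.ne']

theorem partitionEntropy_pi_le {I : Type*} [DecidableEq I] (e : I → X → ι)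
    (he : ∀ i, Measurable (e i)) (s : Finset I) :
    partitionEntropy μ (fun x (i : s) => e i x) ≤ ∑ i ∈ s, partitionEntropy μ (e i) := by
  induction s using Finset.induction_on with
  | empty =>
    refine (partitionEntropy_le_log_ncard_range (ι := (∅ : Finset I) → ι) μ
      (measurable_pi_lambda _ fun i => he i)).trans ?_
    rw [Finset.sum_empty]
    refine Real.log_nonpos (by positivity) ?_
    exact_mod_cast Set.ncard_le_one_of_subsingleton _
  | insert a s ha ih =>
    rw [Finset.sum_insert ha]
    have hs : Measurable fun x (i : s) => e i x := measurable_pi_lambda _ fun i => he i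
    refine (partitionEntropy_comp_le μ ((he a).prodMk hs)
      (fun p (i : (insert a s : Finset I)) =>
        if h : i.1 ∈ s then p.2 ⟨i.1, h⟩ else p.1) ?_).trans
      ((partitionEntropy_prodMk_le μ (he a) hs).trans (by gcongr))
    intro x
    funext i
    by_cases h : i.1 ∈ s
    · simp [h]
    · have : i.1 = a := (Finset.mem_insert.1 i.2).resolve_right h
      simp [this]

end Shannon

/-! ### Uniqueness of normalized Haar measure -/

section Haar

variable {X Y : Type*} [AddCommGroup X] [TopologicalSpace X] [IsTopologicalAddGroup X]
  [CompactSpace X] [MeasurableSpace X] [BorelSpace X]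
  [AddCommGroup Y] [TopologicalSpace Y] [IsTopologicalAddGroup Y]
  [CompactSpace Y] [MeasurableSpace Y] [BorelSpace Y]

instance haarProb_isAddHaarMeasure : (haarProb X).IsAddHaarMeasure := by
  unfold haarProb
  infer_instance

instance haarProb_isProbabilityMeasure : IsProbabilityMeasure (haarProb X) :=
  ⟨Measure.addHaarMeasure_self⟩

theorem haarProb_prod [BorelSpace (X × Y)] :
    haarProb (X × Y) = (haarProb X).prod (haarProb Y) :=
  Measure.isAddHaarMeasure_eq_of_isProbabilityMeasure _ _

theorem AlgebraicAction.measurePreserving {d : ℕ} (α : AlgebraicAction d X) (n : Fin d → ℤ) :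
    MeasurePreserving (α.act n) (haarProb X) (haarProb X) := by
  have hm : Measurable (α.act n) := (α.act n).continuous_toFun.measurable
  refine ⟨hm, ?_⟩
  have h1 : ((haarProb X).map (α.act n)).IsAddHaarMeasure :=
    (α.act n).isAddHaarMeasure_map (haarProb X)
  have h2 : IsProbabilityMeasure ((haarProb X).map (α.act n)) :=
    Measure.isProbabilityMeasure_map hm.aemeasurable
  exact Measure.isAddHaarMeasure_eq_of_isProbabilityMeasure _ _

end Haar

/-! ### Mixing tested on a generating π-system -/

section Mixing

variable {X : Type*} [MeasurableSpace X] {μ : Measure X} [IsProbabilityMeasure μ] {I : Type*}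
  {l : Filter I} {T : I → X → X}

theorem hasSum_measureReal_iUnion {A : ℕ → Set X} (hA : ∀ n, MeasurableSet (A n))
    (hd : Pairwise (Function.onFun Disjoint A)) :
    HasSum (fun n => μ.real (A n)) (μ.real (⋃ n, A n)) := by
  have h := measure_iUnion (μ := μ) hd hA
  have hne : ∑' n, μ (A n) ≠ ⊤ := h ▸ measure_ne_top _ _
  have hs := ENNReal.hasSum_toReal hne
  rwa [← ENNReal.tsum_toReal_eq (fun n => measure_ne_top _ _), ← h] at hs

theorem tendsto_measureReal_inter_of_iUnion_left (hT : ∀ i, MeasurePreserving (T i) μ μ)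
    {A : ℕ → Set X} (hA : ∀ n, MeasurableSet (A n)) (hd : Pairwise (Function.onFun Disjoint A))
    {B : Set X} (hB : MeasurableSet B)
    (h : ∀ n, Tendsto (fun i => μ.real (A n ∩ T i ⁻¹' B)) l (𝓝 (μ.real (A n) * μ.real B))) :
    Tendsto (fun i => μ.real ((⋃ n, A n) ∩ T i ⁻¹' B)) l
      (𝓝 (μ.real (⋃ n, A n) * μ.real B)) := by
  have hs := hasSum_measureReal_iUnion (μ := μ) hA hd
  have e : ∀ i, μ.real ((⋃ n, A n) ∩ T i ⁻¹' B) = ∑' n, μ.real (A n ∩ T i ⁻¹' B) := by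
    intro i
    rw [Set.iUnion_inter, (hasSum_measureReal_iUnion (μ := μ)
      (fun n => (hA n).inter ((hT i).measurable hB)) fun m n hmn =>
        (hd hmn).mono Set.inter_subset_left Set.inter_subset_left).tsum_eq]
  simp only [e]
  rw [← hs.tsum_eq, ← tsum_mul_right]
  refine tendsto_tsum_of_dominated_convergence hs.summable h
    (Eventually.of_forall fun i n => ?_)
  rw [Real.norm_of_nonneg measureReal_nonneg]
  exact measureReal_mono Set.inter_subset_left

/-- Dominated convergence for series; the dominating terms `μ (B n)` are independent of `i` because
each `T i` preserves `μ`. -/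
theorem tendsto_measureReal_inter_of_iUnion_right (hT : ∀ i, MeasurePreserving (T i) μ μ)
    {B : ℕ → Set X} (hB : ∀ n, MeasurableSet (B n)) (hd : Pairwise (Function.onFun Disjoint B))
    {A : Set X} (hA : MeasurableSet A)
    (h : ∀ n, Tendsto (fun i => μ.real (A ∩ T i ⁻¹' (B n))) l (𝓝 (μ.real A * μ.real (B n)))) :
    Tendsto (fun i => μ.real (A ∩ T i ⁻¹' (⋃ n, B n))) l
      (𝓝 (μ.real A * μ.real (⋃ n, B n))) := by
  have hs := hasSum_measureReal_iUnion (μ := μ) hB hd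
  have e : ∀ i, μ.real (A ∩ T i ⁻¹' (⋃ n, B n)) = ∑' n, μ.real (A ∩ T i ⁻¹' (B n)) := by
    intro i
    rw [Set.preimage_iUnion, Set.inter_iUnion, (hasSum_measureReal_iUnion (μ := μ)
      (fun n => hA.inter ((hT i).measurable (hB n))) fun m n hmn =>
        ((hd hmn).preimage _).mono Set.inter_subset_right Set.inter_subset_right).tsum_eq]
  simp only [e]
  rw [← hs.tsum_eq, ← tsum_mul_left]
  refine tendsto_tsum_of_dominated_convergence hs.summable h
    (Eventually.of_forall fun i n => ?_)
  rw [Real.norm_of_nonneg measureReal_nonneg,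
    ← (hT i).measureReal_preimage (hB n).nullMeasurableSet]
  exact measureReal_mono Set.inter_subset_right

/-- Dynkin's π-λ argument twice: in `A` with `B` fixed in `C`, then in `B` with `A` an arbitrary
measurable set. -/
theorem tendsto_measureReal_inter_of_piSystem (hT : ∀ i, MeasurePreserving (T i) μ μ)
    {C : Set (Set X)} (hC : ‹MeasurableSpace X› = MeasurableSpace.generateFrom C)
    (hpi : IsPiSystem C)
    (h : ∀ A ∈ C, ∀ B ∈ C, Tendsto (fun i => μ.real (A ∩ T i ⁻¹' B)) l
      (𝓝 (μ.real A * μ.real B)))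
    {A B : Set X} (hA : MeasurableSet A) (hB : MeasurableSet B) :
    Tendsto (fun i => μ.real (A ∩ T i ⁻¹' B)) l (𝓝 (μ.real A * μ.real B)) := by
  have hCm : ∀ A ∈ C, MeasurableSet A := fun A hA => by
    rw [hC]; exact MeasurableSpace.measurableSet_generateFrom hA
  have left : ∀ B ∈ C, ∀ A, MeasurableSet A →
      Tendsto (fun i => μ.real (A ∩ T i ⁻¹' B)) l (𝓝 (μ.real A * μ.real B)) := by
    intro B hB A hA
    induction A, hA using MeasurableSpace.induction_on_inter hC hpi with
    | empty => simpa using tendsto_const_nhds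
    | basic A hA => exact h A hA B hB
    | compl A hA ih =>
      have e : ∀ i, μ.real (Aᶜ ∩ T i ⁻¹' B) = μ.real B - μ.real (A ∩ T i ⁻¹' B) := by
        intro i
        rw [← (hT i).measureReal_preimage (hCm B hB).nullMeasurableSet,
          ← measureReal_inter_add_sdiff (μ := μ) (s := T i ⁻¹' B) hA]
        rw [Set.inter_comm A, Set.inter_comm Aᶜ, Set.sdiff_eq]
        ring
      simp only [e]
      rw [probReal_compl_eq_one_sub hA, sub_mul, one_mul]
      exact tendsto_const_nhds.sub ih
    | iUnion A hd hA ih =>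
      exact tendsto_measureReal_inter_of_iUnion_left hT hA hd (hCm B hB) ih
  induction B, hB using MeasurableSpace.induction_on_inter hC hpi with
  | empty => simpa using tendsto_const_nhds
  | basic B hB => exact left B hB A hA
  | compl B hB ih =>
    have e : ∀ i, μ.real (A ∩ T i ⁻¹' Bᶜ) = μ.real A - μ.real (A ∩ T i ⁻¹' B) := by
      intro i
      rw [← measureReal_inter_add_sdiff (μ := μ) (s := A) ((hT i).measurable hB),
        Set.preimage_compl, Set.sdiff_eq]
      ring
    simp only [e]
    rw [probReal_compl_eq_one_sub hB, mul_sub, mul_one]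
    exact tendsto_const_nhds.sub ih
  | iUnion B hd hB ih =>
    exact tendsto_measureReal_inter_of_iUnion_right hT hB hd hA ih

end Mixing

/-! ### Products of mixing actions -/

section ProdMixing

variable {X Y : Type*} [AddCommGroup X] [TopologicalSpace X] [IsTopologicalAddGroup X]
  [CompactSpace X] [MeasurableSpace X] [BorelSpace X]
  [AddCommGroup Y] [TopologicalSpace Y] [IsTopologicalAddGroup Y]
  [CompactSpace Y] [MeasurableSpace Y] [BorelSpace Y] {d : ℕ}

theorem AlgebraicAction.isMixing_iff_measureReal (α : AlgebraicAction d X) :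
    α.IsMixing ↔ ∀ A B : Set X, MeasurableSet A → MeasurableSet B →
      Tendsto (fun n : Fin d → ℤ => (haarProb X).real (A ∩ α.act n ⁻¹' B)) cofinite
        (𝓝 ((haarProb X).real A * (haarProb X).real B)) := by
  refine forall₄_congr fun A B _ _ => ?_
  rw [← ENNReal.tendsto_toReal_iff (fun _ => measure_ne_top _ _)
    (ENNReal.mul_ne_top (measure_ne_top _ _) (measure_ne_top _ _)), ENNReal.toReal_mul]
  rfl

theorem AlgebraicAction.IsMixing.prod [BorelSpace (X × Y)] {α : AlgebraicAction d X}
    {β : AlgebraicAction d Y} (hα : α.IsMixing) (hβ : β.IsMixing) : (α.prod β).IsMixing := by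
  rw [isMixing_iff_measureReal] at *
  intro A B hA hB
  refine tendsto_measureReal_inter_of_piSystem (T := fun n => (α.prod β).act n)
    (fun n => (α.prod β).measurePreserving n) generateFrom_prod.symm isPiSystem_prod ?_ hA hB
  rintro _ ⟨A₁, hA₁, A₂, hA₂, rfl⟩ _ ⟨B₁, hB₁, B₂, hB₂, rfl⟩
  have e : ∀ n, (A₁ ×ˢ A₂) ∩ (α.prod β).act n ⁻¹' (B₁ ×ˢ B₂) =
      (A₁ ∩ α.act n ⁻¹' B₁) ×ˢ (A₂ ∩ β.act n ⁻¹' B₂) := by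
    intro n
    ext ⟨x, y⟩
    change (_ ∧ _) ∧ (_ ∧ _) ↔ (_ ∧ _) ∧ (_ ∧ _)
    tauto
  simp only [e, haarProb_prod, measureReal_prod_prod]
  rw [mul_mul_mul_comm]
  exact (hα A₁ B₁ hA₁ hB₁).mul (hβ A₂ B₂ hA₂ hB₂)

end ProdMixing

theorem Set.ncard_range_le_of_factors {X Y Z : Type*} [Finite Y] {f : X → Z} {g : X → Y}
    (h : ∀ x y, g x = g y → f x = f y) : (Set.range f).ncard ≤ (Set.range g).ncard := by
  rcases isEmpty_or_nonempty X with hX | ⟨⟨x₀⟩⟩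
  · simp [Set.range_eq_empty]
  have : Nonempty Z := ⟨f x₀⟩
  obtain ⟨e, he⟩ := (Function.factorsThrough_iff f).1 fun x y hxy => h x y hxy
  rw [he, Set.range_comp]
  exact Set.ncard_image_le (Set.toFinite _)

theorem Real.log_natCast_le_log_natCast {m n : ℕ} (h : m ≤ n) :
    Real.log (m : ℝ) ≤ Real.log (n : ℝ) := by
  rcases Nat.eq_zero_or_pos m with rfl | hm
  · simpa using Real.log_natCast_nonneg n
  · exact Real.log_le_log (by exact_mod_cast hm) (by exact_mod_cast h)

theorem card_cube (d n : ℕ) : (cube d n).card = n ^ d := by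
  simp [cube]

theorem mem_cube {d n : ℕ} {i : Fin d → ℤ} : i ∈ cube d n ↔ ∀ k, 0 ≤ i k ∧ i k < n := by
  simp [cube]

/-! ### Generators, subexponential name counts and zero entropy -/

section Names

variable {d : ℕ} {X : Type*} [AddCommGroup X] [TopologicalSpace X]

/-- The name of a point with respect to a labelling `c` on a finite window `F`. -/
def AlgebraicAction.name (α : AlgebraicAction d X) {A : Type*} (c : X → A)
    (F : Finset (Fin d → ℤ)) (x : X) : F → A :=
  fun i => c (α.act i x)

/-- The number of names on the cube `{0, …, n - 1}^d` grows subexponentially in `n^d`. -/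
def AlgebraicAction.HasSubexpNames (α : AlgebraicAction d X) {A : Type*} (c : X → A) : Prop :=
  Tendsto (fun n : ℕ => Real.log (Set.range (α.name c (cube d n))).ncard / (n : ℝ) ^ d) atTop (𝓝 0)

/-- A continuous labelling whose names on all of `ℤ^d` separate points. -/
structure AlgebraicAction.IsGenerator (α : AlgebraicAction d X) {A : Type*} [TopologicalSpace A]
    (c : X → A) : Prop where
  continuous : Continuous c
  separates : ∀ x y, (∀ i, c (α.act i x) = c (α.act i y)) → x = y

variable {α : AlgebraicAction d X} {A : Type*} {c : X → A}

theorem AlgebraicAction.name_eq_iff {F : Finset (Fin d → ℤ)} {x y : X} :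
    α.name c F x = α.name c F y ↔ ∀ i ∈ F, c (α.act i x) = c (α.act i y) := by
  simp [funext_iff, name]

theorem AlgebraicAction.continuous_name [TopologicalSpace A] (hc : Continuous c)
    (F : Finset (Fin d → ℤ)) : Continuous (α.name c F) :=
  continuous_pi fun i => hc.comp (α.act i).continuous_toFun

/-- Full names embed `X` as a closed subspace of a product of discrete spaces, so every point has a
cylinder neighbourhood inside a member of the cover. Finitely many cylinders suffice, and the union
of their windows serves as `F`. -/
theorem AlgebraicAction.IsGenerator.exists_selection [CompactSpace X] [TopologicalSpace A]
    [DiscreteTopology A] (hc : α.IsGenerator c) {κ : Type*} {U : κ → Set X}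
    (hU : ∀ j, IsOpen (U j)) (hcov : ⋃ j, U j = Set.univ) :
    ∃ (F : Finset (Fin d → ℤ)) (g : (F → A) → κ), ∀ x, x ∈ U (g (α.name c F x)) := by
  classical
  have hcont : Continuous fun (x : X) (i : Fin d → ℤ) => c (α.act i x) :=
    continuous_pi fun i => hc.continuous.comp (α.act i).continuous_toFun
  have hemb := hcont.isClosedEmbedding fun x y h => hc.separates x y (congrFun h)
  have hloc : ∀ x, ∃ (j : κ) (F : Finset (Fin d → ℤ)),
      ∀ y, α.name c F y = α.name c F x → y ∈ U j := by
    intro x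
    obtain ⟨j, hj⟩ := Set.mem_iUnion.1 (hcov ▸ Set.mem_univ x)
    obtain ⟨V, hV, hVU⟩ := hemb.isInducing.isOpen_iff.1 (hU j)
    obtain ⟨F, u, hu, hsub⟩ := isOpen_pi_iff.1 hV (fun i => c (α.act i x)) (by
      rw [← hVU] at hj; exact hj)
    refine ⟨j, F, fun y hy => ?_⟩
    rw [← hVU]
    refine hsub fun i hi => ?_
    simp only [name_eq_iff.1 hy i hi]
    exact (hu i hi).2
  choose j F hF using hloc
  obtain ⟨t, -, ht⟩ := isCompact_univ.elim_nhds_subcover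
    (fun x => α.name c (F x) ⁻¹' {α.name c (F x) x}) fun x _ =>
      ((isOpen_discrete _).preimage (continuous_name hc.continuous _)).mem_nhds rfl
  have hex : ∀ y, ∃ k : κ, ∀ z, α.name c (t.biUnion F) z = α.name c (t.biUnion F) y → z ∈ U k := by
    intro y
    obtain ⟨x, hx, hyx⟩ := Set.mem_iUnion₂.1 (ht (Set.mem_univ y))
    refine ⟨j x, fun z hz => hF x z ?_⟩
    rw [← show α.name c (F x) y = α.name c (F x) x from hyx, name_eq_iff]
    exact fun i hi => name_eq_iff.1 hz i (Finset.mem_biUnion.2 ⟨x, hx, hi⟩)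
  choose k hk using hex
  refine ⟨t.biUnion F, fun w => if h : ∃ y, α.name c (t.biUnion F) y = w then k h.choose
    else k 0, fun x => ?_⟩
  have h : ∃ y, α.name c (t.biUnion F) y = α.name c (t.biUnion F) x := ⟨x, rfl⟩
  simp only [dif_pos h]
  exact hk _ _ h.choose_spec.symm

theorem AlgebraicAction.ncard_range_name_pos [Finite A] (α : AlgebraicAction d X) (c : X → A)
    (F : Finset (Fin d → ℤ)) :
    0 < (Set.range (α.name c F)).ncard :=
  (Set.ncard_pos (Set.toFinite _)).2 ⟨_, Set.mem_range_self 0⟩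

theorem Finset.exists_abs_le_of_pi {ι : Type*} [Fintype ι] (F : Finset (ι → ℤ)) :
    ∃ m : ℕ, ∀ j ∈ F, ∀ k, |j k| ≤ m := by
  classical
  refine ⟨F.sup fun j => Finset.univ.sup fun k => (j k).natAbs, fun j hj k => ?_⟩
  have h1 : (j k).natAbs ≤ Finset.univ.sup fun k => (j k).natAbs :=
    Finset.le_sup (f := fun k => (j k).natAbs) (Finset.mem_univ k)
  have h2 := Finset.le_sup (f := fun j : ι → ℤ => Finset.univ.sup fun k => (j k).natAbs) hj
  have := h1.trans h2
  rw [Int.abs_eq_natAbs]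
  exact_mod_cast this

/-- A block code with window in `[-m, m]^d` reads, over a cube of side `n`, only a cube of side `n +
2m`, and the ratio of the two volumes tends to 1. -/
theorem AlgebraicAction.HasSubexpNames.comp_name [Finite A] (hs : α.HasSubexpNames c) {κ : Type*}
    (F : Finset (Fin d → ℤ)) (g : (F → A) → κ) :
    α.HasSubexpNames fun x => g (α.name c F x) := by
  obtain ⟨m, hm⟩ := F.exists_abs_le_of_pi
  have hle : ∀ n, (Set.range (α.name (fun x => g (α.name c F x)) (cube d n))).ncard ≤
      (Set.range (α.name c (cube d (n + 2 * m)))).ncard := by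
    intro n
    refine (Set.ncard_range_le_of_factors
      -- Acting by `-m` first moves the enlarged window `{-m, …, n + m - 1}^d` onto the standard
      -- cube.
      (g := fun x => α.name c (cube d (n + 2 * m)) (α.act (fun _ => -(m : ℤ)) x)) ?_).trans
      (Set.ncard_le_ncard ?_ (Set.toFinite _))
    · intro x y hxy
      rw [name_eq_iff] at hxy ⊢
      intro i hi
      rw [mem_cube] at hi
      congr 1
      rw [name_eq_iff]
      intro j hj
      have := hxy (j + i + fun _ => (m : ℤ)) (by
        rw [mem_cube]
        intro k
        have := abs_le.1 (hm j hj k)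
        have := hi k
        simp only [Pi.add_apply]
        push_cast
        constructor <;> linarith)
      rw [← α.act_add, ← α.act_add] at this
      have e : (j + i + fun _ => (m : ℤ)) + (fun _ => -(m : ℤ)) = j + i := by
        funext k
        simp
      rwa [e, α.act_add, α.act_add] at this
    · rintro _ ⟨x, rfl⟩
      exact ⟨_, rfl⟩
  have hlim : Tendsto (fun n : ℕ =>
      Real.log (Set.range (α.name c (cube d (n + 2 * m)))).ncard / ((n + 2 * m : ℕ) : ℝ) ^ d *
        (((n + 2 * m : ℕ) : ℝ) / n) ^ d) atTop (𝓝 0) := by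
    have h1 := hs.comp (tendsto_add_atTop_nat (2 * m))
    have h2 : Tendsto (fun n : ℕ => (((n + 2 * m : ℕ) : ℝ) / n)) atTop (𝓝 1) := by
      have h3 : Tendsto (fun n : ℕ => 1 + ((2 * m : ℕ) : ℝ) / n) atTop (𝓝 (1 + 0)) :=
        tendsto_const_nhds.add (tendsto_const_div_atTop_nhds_zero_nat _)
      rw [add_zero] at h3
      refine h3.congr' ?_
      filter_upwards [eventually_gt_atTop 0] with n hn
      have : (n : ℝ) ≠ 0 := by exact_mod_cast hn.ne'
      push_cast
      field_simp
    simpa using h1.mul (h2.pow d)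
  refine squeeze_zero' (Eventually.of_forall fun n => ?_) ?_ hlim
  · exact div_nonneg (Real.log_natCast_nonneg _) (by positivity)
  · filter_upwards [eventually_gt_atTop 0] with n hn
    have h0 : (n : ℝ) ≠ 0 := by exact_mod_cast hn.ne'
    have h1 : ((n + 2 * m : ℕ) : ℝ) ≠ 0 := by
      have : n + 2 * m ≠ 0 := by omega
      exact_mod_cast this
    rw [div_pow, div_mul_div_cancel₀ (pow_ne_zero _ h1)]
    refine div_le_div_of_nonneg_right ?_ (by positivity)
    exact Real.log_natCast_le_log_natCast (hle n)

theorem AlgebraicAction.IsGenerator.topEntropy_eq_zero [CompactSpace X] [TopologicalSpace A]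
    [DiscreteTopology A] [Finite A] (hc : α.IsGenerator c) (hs : α.HasSubexpNames c) :
    α.topEntropy = 0 := by
  classical
  unfold topEntropy
  simp only [ENNReal.iSup_eq_zero]
  intro k U hU hcov
  obtain ⟨F, g, hg⟩ := hc.exists_selection hU hcov
  have hψ := hs.comp_name F g
  have hle : ∀ n, coverNumber (fun w : cube d n → Fin k =>
      ⋂ i : cube d n, α.act i ⁻¹' U (w i)) ≤
      (Set.range (α.name (fun x => g (α.name c F x)) (cube d n))).ncard := by
    intro n
    refine Nat.sInf_le ⟨(Set.range (α.name (fun x => g (α.name c F x)) (cube d n))).toFinset,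
      (Set.ncard_eq_toFinset_card' _).symm, ?_⟩
    refine Set.eq_univ_of_forall fun x => ?_
    simp only [Set.mem_iUnion, Set.mem_iInter]
    exact ⟨_, by rw [Set.mem_toFinset]; exact ⟨x, rfl⟩, fun i => hg _⟩
  refine Tendsto.limsup_eq ?_
  rw [← ENNReal.ofReal_zero]
  refine (ENNReal.continuous_ofReal.tendsto 0).comp ?_
  refine squeeze_zero (fun n => div_nonneg (Real.log_natCast_nonneg _) (by positivity))
    (fun n => ?_) hψ
  refine div_le_div_of_nonneg_right ?_ (by positivity)
  exact Real.log_natCast_le_log_natCast (hle n)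

/-- Inner regularity gives compact sets `K j` filling the atoms up to `ε / k`. A selection from the
open cover by complements of `⋃ i ≠ j, K i` must be correct on every `K j`. -/
theorem AlgebraicAction.IsGenerator.exists_approx [CompactSpace X] [T2Space X]
    [MeasurableSpace X] [BorelSpace X] [TopologicalSpace A] [DiscreteTopology A]
    (hc : α.IsGenerator c) (μ : Measure X) [IsFiniteMeasure μ] [μ.InnerRegularCompactLTTop]
    {k : ℕ} {φ : X → Fin k} (hφ : Measurable φ) {ε : ℝ} (hε : 0 < ε) :
    ∃ (F : Finset (Fin d → ℤ)) (g : (F → A) → Fin k),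
      μ.real {x | φ x ≠ g (α.name c F x)} ≤ ε := by
  have hk : (0 : ℝ) < k := by exact_mod_cast (φ 0).pos
  have hK : ∀ j, ∃ K ⊆ φ ⁻¹' {j}, IsCompact K ∧
      μ (φ ⁻¹' {j} \ K) < ENNReal.ofReal (ε / k) := fun j =>
    (hφ (measurableSet_singleton j)).exists_isCompact_sdiff_lt (measure_ne_top _ _)
      (ENNReal.ofReal_pos.2 (div_pos hε hk)).ne'
  choose K hKsub hKc hKμ using hK
  obtain ⟨F, g, hg⟩ := hc.exists_selection (U := fun j => (⋃ i ∈ {i | i ≠ j}, K i)ᶜ)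
    (fun j => ((Set.toFinite _).isClosed_biUnion fun i _ => (hKc i).isClosed).isOpen_compl) (by
      refine Set.eq_univ_of_forall fun x => Set.mem_iUnion.2 ⟨φ x, ?_⟩
      simp only [Set.mem_compl_iff, Set.mem_iUnion, not_exists]
      intro i hi hx
      exact hi (hKsub i hx).symm)
  refine ⟨F, g, ?_⟩
  have hsub : {x | φ x ≠ g (α.name c F x)} ⊆ ⋃ j, φ ⁻¹' {j} \ K j := by
    intro x hx
    refine Set.mem_iUnion.2 ⟨φ x, rfl, fun hxK => ?_⟩
    have := hg x
    simp only [Set.mem_compl_iff, Set.mem_iUnion, not_exists] at this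
    exact this (φ x) hx hxK
  calc μ.real {x | φ x ≠ g (α.name c F x)}
      ≤ μ.real (⋃ j, φ ⁻¹' {j} \ K j) := measureReal_mono hsub
    _ ≤ ∑ j, μ.real (φ ⁻¹' {j} \ K j) := measureReal_iUnion_fintype_le _
    _ ≤ ∑ _j : Fin k, ε / k := Finset.sum_le_sum fun j _ => by
        rw [Measure.real]
        exact ENNReal.toReal_le_of_le_ofReal (by positivity) (hKμ j).le
    _ = ε := by
        rw [Finset.sum_const, Finset.card_univ, Fintype.card_fin, nsmul_eq_mul]
        field_simp

/-- Write `φ = ψ + (φ - ψ)` with `ψ` a finite-window function. The names of `ψ` cost at most the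
logarithm of their number, which is `o(n ^ d)`; by subadditivity and invariance the rarely nonzero
error costs at most `δ` per site. -/
theorem AlgebraicAction.IsGenerator.metricEntropy_eq_zero [IsTopologicalAddGroup X]
    [CompactSpace X] [T2Space X] [MeasurableSpace X] [BorelSpace X] [TopologicalSpace A]
    [DiscreteTopology A] [Finite A] (hc : α.IsGenerator c) (hs : α.HasSubexpNames c) :
    α.metricEntropy = 0 := by
  unfold metricEntropy
  simp only [ENNReal.iSup_eq_zero]
  intro k φ hφ
  -- `Fin (l + 1)` is a cyclic group, so the difference of two labellings makes sense.
  obtain ⟨k, rfl⟩ : ∃ l, k = l + 1 := Nat.exists_eq_succ_of_ne_zero (φ 0).pos.ne'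
  have main : ∀ δ : ℝ, 0 < δ → limsup (fun n : ℕ => ENNReal.ofReal
      (partitionEntropy (haarProb X) (fun x (i : cube d n) => φ (α.act i x)) / (n : ℝ) ^ d)) atTop
        ≤ ENNReal.ofReal (2 * δ) := by
    intro δ hδ
    obtain ⟨ε, hε, hconc⟩ := exists_partitionEntropy_le_of_concentrated (haarProb X)
      (0 : Fin (k + 1)) hδ
    obtain ⟨F, g, hg⟩ := hc.exists_approx (haarProb X) hφ hε
    set ψ : X → Fin (k + 1) := fun x => g (α.name c F x) with hψdef
    have hψ : Measurable ψ := fun s _ =>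
      ((isOpen_discrete (g ⁻¹' s)).preimage (continuous_name hc.continuous F)).measurableSet
    have he : Measurable fun x => φ x - ψ x := hφ.sub hψ
    have hent : partitionEntropy (haarProb X) (fun x => φ x - ψ x) ≤ δ := by
      refine hconc _ (he (measurableSet_singleton _)) ?_
      simpa only [ne_eq, sub_eq_zero] using hg
    have hact : ∀ i, Measurable (α.act i) := fun i => (α.measurePreserving i).measurable
    have hbound : ∀ n : ℕ,
        partitionEntropy (haarProb X) (fun x (i : cube d n) => φ (α.act i x)) ≤
          Real.log (Set.range (α.name ψ (cube d n))).ncard + (n : ℝ) ^ d * δ := by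
      intro n
      have h1 : Measurable (α.name ψ (cube d n)) :=
        measurable_pi_lambda _ fun i => hψ.comp (hact i)
      have h2 : Measurable fun x (i : cube d n) => φ (α.act i x) - ψ (α.act i x) :=
        measurable_pi_lambda _ fun i => he.comp (hact i)
      refine (partitionEntropy_comp_le (haarProb X) (h1.prodMk h2)
        (fun p i => p.2 i + p.1 i) fun x => by
          funext i
          simp [name]).trans ((partitionEntropy_prodMk_le _ h1 h2).trans ?_)
      gcongr
      · exact partitionEntropy_le_log_ncard_range _ h1
      · refine (partitionEntropy_pi_le (haarProb X)
          (fun i x => φ (α.act i x) - ψ (α.act i x)) (fun i => he.comp (hact i)) _).trans ?_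
        have h3 : ∀ i ∈ cube d n, partitionEntropy (haarProb X)
            (fun x => φ (α.act i x) - ψ (α.act i x)) ≤ δ := fun i _ =>
          (partitionEntropy_comp_of_measurePreserving (α.measurePreserving i) he).trans_le hent
        refine (Finset.sum_le_sum h3).trans ?_
        rw [Finset.sum_const, card_cube, nsmul_eq_mul]
        push_cast
        exact le_rfl
    refine limsup_le_of_le (by isBoundedDefault) ?_
    filter_upwards [(hs.comp_name F g).eventually (gt_mem_nhds hδ), eventually_gt_atTop 0]
      with n hn hn0
    refine ENNReal.ofReal_le_ofReal ?_
    have hpos : (0 : ℝ) < (n : ℝ) ^ d := by positivity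
    rw [div_lt_iff₀ hpos] at hn
    rw [div_le_iff₀ hpos]
    linarith [hbound n]
  refine le_antisymm (ENNReal.le_of_forall_pos_le_add fun δ hδ _ => ?_) zero_le
  have := main (δ / 2) (by positivity)
  rwa [mul_div_cancel₀ _ two_ne_zero, ENNReal.ofReal_coe_nnreal, ← zero_add (δ : ℝ≥0∞)] at this

section Prod

variable {Y : Type*} [AddCommGroup Y] [TopologicalSpace Y] {β : AlgebraicAction d Y} {B : Type*}
  {b : Y → B}

theorem AlgebraicAction.IsGenerator.prod [TopologicalSpace A] [TopologicalSpace B]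
    (hc : α.IsGenerator c) (hb : β.IsGenerator b) : (α.prod β).IsGenerator (Prod.map c b) where
  continuous := hc.continuous.prodMap hb.continuous
  separates _ _ h := Prod.ext
    (hc.separates _ _ fun i => congrArg Prod.fst (h i))
    (hb.separates _ _ fun i => congrArg Prod.snd (h i))

theorem AlgebraicAction.HasSubexpNames.prod [Finite A] [Finite B] (hc : α.HasSubexpNames c)
    (hb : β.HasSubexpNames b) : (α.prod β).HasSubexpNames (Prod.map c b) := by
  have h := Tendsto.add hc hb
  rw [add_zero] at h
  refine squeeze_zero (fun n => div_nonneg (Real.log_natCast_nonneg _) (by positivity))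
    (fun n => ?_) h
  rw [← add_div, ← Real.log_mul (by exact_mod_cast (α.ncard_range_name_pos c _).ne')
    (by exact_mod_cast (β.ncard_range_name_pos b _).ne')]
  refine div_le_div_of_nonneg_right ?_ (by positivity)
  rw [← Nat.cast_mul]
  refine Real.log_natCast_le_log_natCast ?_
  rw [← Set.ncard_prod, ← Set.range_prodMap]
  refine Set.ncard_range_le_of_factors fun x y hxy => ?_
  rw [name_eq_iff]
  intro i hi
  exact Prod.ext (name_eq_iff.1 (congrArg Prod.fst hxy) i hi)
    (name_eq_iff.1 (congrArg Prod.snd hxy) i hi)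

end Prod

end Names

/-! ### The linear relation of a proper Markov subgroup -/

section Relation

variable {d : ℕ}

theorem MarkovSubgroup.exists_window_notMem (H : MarkovSubgroup d) {x : ConfigSpace d}
    (hx : x ∉ H.toAddSubgroup) :
    ∃ W : Finset (Fin d → ℤ), ∀ y ∈ H.toAddSubgroup, ∃ i ∈ W, y i ≠ x i := by
  obtain ⟨W, u, hu, hsub⟩ := isOpen_pi_iff.1 H.isClosed'.isOpen_compl x hx
  refine ⟨W, fun y hy => ?_⟩
  by_contra! h
  refine hsub (a := y) (fun i hi => ?_) hy
  rw [h i hi]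
  exact (hu i hi).2

/-- The restrictions of `H` to a suitable finite window form a proper subspace, which some nonzero
functional annihilates. Over `ZMod 2` a functional is the sum over the set `S` of sites where its
coefficient is nonzero. -/
theorem MarkovSubgroup.exists_relation (H : MarkovSubgroup d) (hH : H.toAddSubgroup ≠ ⊤) :
    ∃ S : Finset (Fin d → ℤ), S.Nonempty ∧
      ∀ x ∈ H.toAddSubgroup, ∀ j, ∑ i ∈ S, x (i + j) = 0 := by
  classical
  obtain ⟨x₀, hx₀⟩ : ∃ x, x ∉ H.toAddSubgroup := by
    by_contra! h
    exact hH (eq_top_iff.2 fun x _ => h x)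
  obtain ⟨W, hW⟩ := H.exists_window_notMem hx₀
  let r : ConfigSpace d →ₗ[ZMod 2] (W → ZMod 2) :=
    LinearMap.funLeft (ZMod 2) (ZMod 2) Subtype.val
  let V : Submodule (ZMod 2) (W → ZMod 2) := (AddSubgroup.toZModSubmodule 2 H.toAddSubgroup).map r
  have hV : r x₀ ∉ V := by
    rintro ⟨y, hy, hyx⟩
    obtain ⟨i, hi, hne⟩ := hW y hy
    exact hne (congrFun hyx ⟨i, hi⟩)
  obtain ⟨f, hf, hfV⟩ := Submodule.exists_le_ker_of_lt_top V
    (lt_top_iff_ne_top.2 fun h => hV (h ▸ Submodule.mem_top))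
  have hsum : ∀ w : W → ZMod 2, f w = ∑ i, w i * f (Pi.single i 1) := by
    intro w
    conv_lhs => rw [pi_eq_sum_univ' w]
    simp [map_sum, Pi.single]
  let S : Finset W := Finset.univ.filter fun i => f (Pi.single i 1) ≠ 0
  have hS : ∀ w : W → ZMod 2, f w = ∑ i ∈ S, w i := by
    intro w
    rw [hsum, Finset.sum_filter]
    refine Finset.sum_congr rfl fun i _ => ?_
    split_ifs with h
    · have h1 : ∀ a : ZMod 2, a ≠ 0 → a = 1 := by decide
      rw [h1 _ h, mul_one]
    · rw [not_ne_iff.1 h, mul_zero]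
  refine ⟨S.map (Function.Embedding.subtype _), ?_, fun x hx j => ?_⟩
  · rw [Finset.map_nonempty]
    by_contra h
    rw [Finset.not_nonempty_iff_eq_empty] at h
    refine hf (LinearMap.ext fun w => ?_)
    rw [hS, h]
    simp
  · rw [Finset.sum_map]
    have : f (r (configShift j x)) = 0 := hfV ⟨_, H.shift_mem' j x hx, rfl⟩
    rw [hS] at this
    exact this

theorem toLex_add_lt_of_lt {v j : Fin d → ℤ} (h : toLex v < 0) : toLex (v + j) < toLex j := by
  have := add_lt_add_left h (toLex j)
  rw [zero_add] at this
  exact this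

/-- At a lexicographically least site of disagreement, the relation expresses the value through
smaller sites of `Q`, where `x` and `y` agree. Lexicographic order serves because it is total and
translation-invariant. -/
theorem eqOn_of_relation {G : Type*} [AddCommGroup G] {S : Finset (Fin d → ℤ)} {m : Fin d → ℤ}
    (hm : m ∈ S) (hmax : ∀ i ∈ S, toLex i ≤ toLex m) {x y : (Fin d → ℤ) → G}
    (hx : ∀ j, ∑ i ∈ S, x (i + j) = 0) (hy : ∀ j, ∑ i ∈ S, y (i + j) = 0)
    {Q R : Finset (Fin d → ℤ)} (hR : ∀ j ∈ R, ∀ i ∈ S, i - m + j ∈ Q)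
    (hxy : ∀ j ∈ Q, j ∉ R → x j = y j) : ∀ j ∈ Q, x j = y j := by
  classical
  by_contra! hne
  obtain ⟨j₁, hj₁, hj₁'⟩ := hne
  obtain ⟨j, hj, hmin⟩ := Finset.exists_min_image (Q.filter fun j => x j ≠ y j) toLex
    ⟨j₁, Finset.mem_filter.2 ⟨hj₁, hj₁'⟩⟩
  rw [Finset.mem_filter] at hj
  have hjR : j ∈ R := by
    by_contra h
    exact hj.2 (hxy j hj.1 h)
  -- Translating by `j - m` places the maximal site `m` of the relation at `j`.
  have hsum := (hx (j - m)).trans (hy (j - m)).symm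
  rw [← Finset.add_sum_erase _ _ hm, ← Finset.add_sum_erase _ _ hm] at hsum
  have hrest : ∑ i ∈ S.erase m, x (i + (j - m)) = ∑ i ∈ S.erase m, y (i + (j - m)) := by
    refine Finset.sum_congr rfl fun i hi => ?_
    rw [Finset.mem_erase] at hi
    have e : i + (j - m) = i - m + j := by abel
    rw [e]
    by_contra hne
    have hlt : toLex (i - m + j) < toLex j := by
      refine toLex_add_lt_of_lt ?_
      rw [toLex_sub, sub_neg]
      exact lt_of_le_of_ne (hmax i hi.2) fun h => hi.1 (toLex.injective h)
    exact absurd (hmin _ (Finset.mem_filter.2 ⟨hR j hjR i hi.2, hne⟩)) (not_le.2 hlt)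
  rw [hrest, add_left_inj, add_sub_cancel] at hsum
  exact hj.2 hsum

end Relation

/-! ### Counting patterns by their boundary layer -/

section Complexity

variable {d : ℕ} (H : MarkovSubgroup d)

/-- The labelling of `H` by the symbol at the origin. -/
def MarkovSubgroup.symbol (x : H.Carrier) : ZMod 2 := x.1 0

theorem MarkovSubgroup.symbol_act (i : Fin d → ℤ) (x : H.Carrier) :
    H.symbol (H.shiftAction.act i x) = x.1 i :=
  congrArg x.1 (zero_add i)

theorem MarkovSubgroup.isGenerator_symbol : H.shiftAction.IsGenerator H.symbol where
  continuous := (continuous_apply 0).comp continuous_subtype_val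
  separates x y h := Subtype.ext (funext fun i => by
    simpa only [symbol_act] using h i)

theorem tendsto_one_sub_div_pow (r d : ℕ) :
    Tendsto (fun n : ℕ => ((n : ℝ) ^ d - ((n : ℝ) - r) ^ d) / (n : ℝ) ^ d) atTop (𝓝 0) := by
  have h3 : Tendsto (fun n : ℕ => 1 - (1 - (r : ℝ) / n) ^ d) atTop (𝓝 (1 - (1 - 0) ^ d)) :=
    tendsto_const_nhds.sub
      ((tendsto_const_nhds.sub (tendsto_const_div_atTop_nhds_zero_nat _)).pow d)
  rw [sub_zero, one_pow, sub_self] at h3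
  refine h3.congr' ?_
  filter_upwards [eventually_gt_atTop 0] with n hn
  have h0 : (n : ℝ) ≠ 0 := by exact_mod_cast hn.ne'
  rw [sub_div, div_self (pow_ne_zero _ h0), ← div_pow, sub_div, div_self h0]

theorem MarkovSubgroup.hasSubexpNames_symbol (hH : H.toAddSubgroup ≠ ⊤) :
    H.shiftAction.HasSubexpNames H.symbol := by
  classical
  obtain ⟨S, hne, hS⟩ := H.exists_relation hH
  obtain ⟨m, hm, hmax⟩ := Finset.exists_max_image S toLex hne
  obtain ⟨r, hr⟩ := (S.image fun i => i - m).exists_abs_le_of_pi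
  have hbound : ∀ n : ℕ, 2 * r ≤ n →
      Real.log (Set.range (H.shiftAction.name H.symbol (cube d n))).ncard ≤
        ((n : ℝ) ^ d - ((n : ℝ) - (2 * r : ℕ)) ^ d) * Real.log 2 := by
    intro n hn
    -- Sites at depth `r` inside the cube: `r` bounds the coordinates of every `i - m`, so a
    -- relation with `m` placed in `R` stays inside the cube.
    set R : Finset (Fin d → ℤ) := Fintype.piFinset fun _ => Finset.Ico (r : ℤ) (n - r) with hRdef
    have hRmem : ∀ j, j ∈ R ↔ ∀ k, (r : ℤ) ≤ j k ∧ j k < n - r := by simp [hRdef]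
    have hRcard : R.card = (n - 2 * r) ^ d := by
      have : ((n : ℤ) - r - r).toNat = n - 2 * r := by omega
      simp [hRdef, this]
    have hRQ : R ⊆ cube d n := by
      intro j hj
      rw [mem_cube]
      intro k
      have := (hRmem j).1 hj k
      omega
    have hle : (Set.range (H.shiftAction.name H.symbol (cube d n))).ncard ≤
        2 ^ (n ^ d - (n - 2 * r) ^ d) := by
      refine (Set.ncard_range_le_of_factors
        (g := H.shiftAction.name H.symbol (cube d n \ R)) fun x y hxy => ?_).trans ?_
      · rw [AlgebraicAction.name_eq_iff] at hxy ⊢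
        simp only [symbol_act] at hxy ⊢
        refine eqOn_of_relation hm hmax (hS _ x.2) (hS _ y.2) (R := R) (fun j hj i hi => ?_)
          fun j hj hjR => hxy j (Finset.mem_sdiff.2 ⟨hj, hjR⟩)
        rw [mem_cube]
        intro k
        have h1 := (hRmem j).1 hj k
        have h2 := abs_le.1 (hr (i - m) (Finset.mem_image_of_mem _ hi) k)
        simp only [Pi.add_apply]
        constructor <;> linarith
      · refine (Set.ncard_le_ncard (Set.subset_univ _) (Set.toFinite _)).trans_eq ?_
        rw [Set.ncard_univ, Nat.card_eq_fintype_card, Fintype.card_fun, ZMod.card,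
          Fintype.card_coe, Finset.card_sdiff_of_subset hRQ, card_cube, hRcard]
    refine (Real.log_natCast_le_log_natCast hle).trans_eq ?_
    rw [Nat.cast_pow, Real.log_pow, Nat.cast_sub (Nat.pow_le_pow_left (Nat.sub_le _ _) _)]
    push_cast [Nat.cast_sub hn]
    rfl
  have hlim := (tendsto_one_sub_div_pow (2 * r) d).mul_const (Real.log 2)
  rw [zero_mul] at hlim
  refine squeeze_zero' (Eventually.of_forall fun n =>
    div_nonneg (Real.log_natCast_nonneg _) (by positivity)) ?_ hlim
  filter_upwards [eventually_ge_atTop (2 * r)] with n hn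
  rw [div_mul_eq_mul_div]
  exact div_le_div_of_nonneg_right (hbound n hn) (by positivity)

end Complexity

/-! ### The shear `f`: invariance of Haar measure and failure of affinity -/

section TripleMap

variable {d : ℕ} {H K : MarkovSubgroup d}
  (hHK : ∀ x ∈ H.toAddSubgroup, ∀ y ∈ H.toAddSubgroup, x * y ∈ K.toAddSubgroup)

theorem tripleMap_involutive : Function.Involutive (tripleMap H K hHK) := by
  rintro ⟨x, y, z⟩
  refine Prod.ext rfl (Prod.ext rfl (Subtype.ext (funext fun i => ?_)))
  change x.1 i * y.1 i + (x.1 i * y.1 i + z.1 i) = z.1 i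
  rw [← add_assoc, CharTwo.add_self_eq_zero, zero_add]

theorem continuous_starMul :
    Continuous fun p : H.Carrier × H.Carrier =>
      (⟨p.1.1 * p.2.1, hHK _ p.1.2 _ p.2.2⟩ : K.Carrier) :=
  ((continuous_subtype_val.comp continuous_fst).mul
    (continuous_subtype_val.comp continuous_snd)).subtype_mk _

theorem continuous_tripleMap : Continuous (tripleMap H K hHK) :=
  continuous_fst.prodMk ((continuous_fst.comp continuous_snd).prodMk
    (((continuous_starMul hHK).comp
      (continuous_fst.prodMk (continuous_fst.comp continuous_snd))).add
        (continuous_snd.comp continuous_snd)))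

theorem isHomeomorph_tripleMap : IsHomeomorph (tripleMap H K hHK) :=
  (Homeomorph.mk ((tripleMap_involutive hHK).toPerm) (continuous_tripleMap hHK)
    (continuous_tripleMap hHK)).isHomeomorph

/-- Two nested skew products over identity maps; the innermost fibre map is translation of `K` by `x
⋆ y`. -/
theorem measurePreserving_tripleMap :
    MeasurePreserving (tripleMap H K hHK) (haarProb (H.Carrier × H.Carrier × K.Carrier))
      (haarProb (H.Carrier × H.Carrier × K.Carrier)) := by
  have hmeas := (continuous_tripleMap hHK).measurable
  have hfib : ∀ x : H.Carrier, MeasurePreserving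
      (fun q : H.Carrier × K.Carrier => (tripleMap H K hHK (x, q)).2)
      (haarProb (H.Carrier × K.Carrier)) (haarProb (H.Carrier × K.Carrier)) := by
    intro x
    rw [haarProb_prod]
    refine (MeasurePreserving.id (haarProb H.Carrier)).skew_product
      (g := fun y z => (tripleMap H K hHK (x, y, z)).2.2)
      (measurable_snd.comp (measurable_snd.comp (hmeas.comp measurable_prodMk_left)))
      (Eventually.of_forall fun y => ?_)
    exact (measurePreserving_add_left (haarProb K.Carrier)
      (⟨x.1 * y.1, hHK _ x.2 _ y.2⟩ : K.Carrier)).map_eq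
  rw [haarProb_prod (X := H.Carrier)]
  exact (MeasurePreserving.id (haarProb H.Carrier)).skew_product
    (g := fun x q => (tripleMap H K hHK (x, q)).2) (measurable_snd.comp hmeas)
    (Eventually.of_forall fun x => (hfib x).map_eq)

theorem not_isAffineMap_tripleMap (hH0 : H.toAddSubgroup ≠ ⊥) :
    ¬ IsAffineMap (tripleMap H K hHK) := by
  rintro ⟨c, θ, -, hθ⟩
  have heq : tripleMap H K hHK = fun p => c + θ p :=
    -- Haar measure charges every nonempty open set, so almost everywhere equality of continuous
    -- maps is equality.
    Continuous.ae_eq_iff_eq (haarProb (H.Carrier × H.Carrier × K.Carrier))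
      (continuous_tripleMap hHK) (continuous_const.add θ.continuous_toFun) |>.1 hθ
  refine hH0 ((AddSubgroup.eq_bot_iff_forall _).2 fun x hx => ?_)
  have hval : ∀ p i, (tripleMap H K hHK p).2.2.1 i = p.1.1 i * p.2.1.1 i + p.2.2.1 i :=
    fun _ _ => rfl
  have hc : ∀ i, c.2.2.1 i = 0 := fun i => by
    have h := hval 0 i
    rw [heq] at h
    simpa using h
  have hadd : ∀ p q i, (tripleMap H K hHK (p + q)).2.2.1 i =
      (tripleMap H K hHK p).2.2.1 i + (tripleMap H K hHK q).2.2.1 i := by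
    intro p q i
    simp [heq, hc i]
  funext i
  -- The biadditive term vanishes on each summand but equals `x ⋆ x` on their sum.
  have h := hadd (⟨x, hx⟩, 0, 0) (0, ⟨x, hx⟩, 0) i
  simp only [hval] at h
  simpa using h

theorem tripleMap_act (n : Fin d → ℤ) (p : H.Carrier × H.Carrier × K.Carrier) :
    tripleMap H K hHK ((tripleAction H K).act n p) =
      (tripleAction H K).act n (tripleMap H K hHK p) :=
  rfl

end TripleMap

theorem proposition4p1 {d : ℕ} (hd : 1 ≤ d) (H K : MarkovSubgroup d)
    (hH : H.toAddSubgroup ≠ ⊤) (hK : K.toAddSubgroup ≠ ⊤) (hH0 : H.toAddSubgroup ≠ ⊥)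
    (hHmix : H.shiftAction.IsMixing) (hKmix : K.shiftAction.IsMixing)
    (hHK : ∀ x ∈ H.toAddSubgroup, ∀ y ∈ H.toAddSubgroup, x * y ∈ K.toAddSubgroup) :
    (tripleAction H K).IsMixing ∧
    (tripleAction H K).metricEntropy = 0 ∧
    (tripleAction H K).topEntropy = 0 ∧
    IsHomeomorph (tripleMap H K hHK) ∧
    ¬ IsAffineMap (tripleMap H K hHK) ∧
    (∀ (n : Fin d → ℤ) (p : H.Carrier × H.Carrier × K.Carrier),
      tripleMap H K hHK ((tripleAction H K).act n p) =
        (tripleAction H K).act n (tripleMap H K hHK p)) ∧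
    MeasurePreserving (tripleMap H K hHK) (haarProb (H.Carrier × H.Carrier × K.Carrier))
      (haarProb (H.Carrier × H.Carrier × K.Carrier)) := by
  have hgen := H.isGenerator_symbol.prod (H.isGenerator_symbol.prod K.isGenerator_symbol)
  have hsub := (H.hasSubexpNames_symbol hH).prod
    ((H.hasSubexpNames_symbol hH).prod (K.hasSubexpNames_symbol hK))
  exact ⟨hHmix.prod (hHmix.prod hKmix), hgen.metricEntropy_eq_zero hsub,
    hgen.topEntropy_eq_zero hsub, isHomeomorph_tripleMap hHK,
    not_isAffineMap_tripleMap hHK hH0, tripleMap_act hHK, measurePreserving_tripleMap hHK⟩
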